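/- **Theorem (Success probability of the V2V shared link).** Let $\lambda_R,\mu_v,P_v>0$, $p\in[0,1]$, $\alpha>1$, $\sigma\in\mathbb R$, $z>0$, and $0<r_v<R\le\infty$. Consider the following network around a typical receiver located at the origin of $\mathbb R^2$. * Roads: a Poisson line process, i.e. the lines $\{x\cos\theta+y'\sin\theta=y\}$ whose parameters $(\theta,y)$ form a Poisson point process with intensity $\lambda_R\,d\theta\,dy$ on $[0,\pi)\times\{|y|<R\}$ ($R=\infty$ gives the stationary process in the plane), together with one further, typical road through the origin. * Nodes: on each road (including the typical one) the nodes form a homogeneous one-dimensional Poisson process with intensity $\mu_v$, and each node transmits, with power $P_v$, with probability $p$; put $\mu_t=p\mu_v$. * Channels: the channel gains $h$ (serving link) and $h_x$ (node $x$) are exponential with unit mean (Rayleigh fading), and the path loss is $d^{-\alpha}$. * Roads, nodes, transmission decisions and channel gains are independent. For a V2V link of given length $r_v$, the minimum distance between the receiver and a transmitter, the interferers are the transmitting nodes at distance larger than $r_v$ from the origin. Let $I_v$ be the sum of $P_v h_x\|x\|^{-\alpha}$ over the interferers $x$ on all roads other than the typical one, $I_r$ the same sum over the interferers on the typical road (sums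 in $[0,\infty]$), and let $\mathcal L_{I}(s|r_v)=\mathbb E[e^{-sI}]$ (with $e^{-\infty}=0$) be their Laplace transforms. Then, with $s=z r_v^{\alpha}/P_v$, $$\Pr\Big[\frac{P_v r_v^{-\alpha}h}{I_v+I_r+\sigma^2}>z\Big]=\exp\Big(-\frac{z\sigma^2r_v^{\alpha}}{P_v}\Big)\,\mathcal L_{I_v}(s|r_v)\,\mathcal L_{I_r}(s|r_v),$$ where $$\mathcal L_{I_v}(s|r_v)=\exp\Big(-2\pi\lambda_R\Big[\int_0^{r_v}\big(1-\mathcal L_{\rm in}(y)\big)dy+\int_{r_v}^{R}\big(1-\mathcal L_{\rm out}(y)\big)dy\Big]\Big),$$ $$\mathcal L_{\rm in}(y)=\exp\Big(-2\mu_t\int_{\sqrt{r_v^2-y^2}}^\infty\Big[1-\frac1{1+sP_v(y^2+t^2)^{-\alpha/2}}\Big]dt\Big),\qquad \mathcal L_{\rm out}(y)=\exp\Big(-2\mu_t\int_0^\infty\Big[1-\frac1{1+sP_v(y^2+t^2)^{-\alpha/2}}\Big]dt\Big),$$ and $$\mathcal L_{I_r}(s|r_v)=\exp\Big(-2\mu_t\int_{r_v}^\infty\Big[1-\frac1{1+sP_vt^{-\alpha}}\Big]dt\Big)=\exp\Big(-\frac{2\,r_v\,z\,\mu_t}{\alpha-1}\;{}_2F_1\big(1,\tfrac{\alpha-1}{\alpha};2-\tfrac1\alpha;-z\big)\Big),$$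 where ${}_2F_1(\cdot,\cdot;\cdot;x)$ for real $x<1$ is given by Euler's integral (the analytic continuation of the hypergeometric series). -/

import Mathlib

open MeasureTheory ProbabilityTheory Set
open scoped ENNReal

namespace V2X

noncomputable section

/-! ### Point processes -/

/-- A random, finite or countably infinite, family of points of `E`, given by a measurable
enumeration: the index `n` carries a point exactly when `present n` is `true`, and then this point
is `pt n`. -/
structure PointProcess (Ω E : Type*) [MeasurableSpace Ω] [MeasurableSpace E] where
  present : ℕ → Ω → Bool
  pt : ℕ → Ω → E
  measurable_present : ∀ n, Measurable (present n)
  measurable_pt : ∀ n, Measurable (pt n)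

namespace PointProcess

variable {Ω E : Type*} [MeasurableSpace Ω] [MeasurableSpace E]

open Classical in
/-- The number of points that lie in `B`. -/
def count (X : PointProcess Ω E) (B : Set E) (ω : Ω) : ℝ≥0∞ :=
  ∑' n, if X.present n ω = true ∧ X.pt n ω ∈ B then 1 else 0

/-- The σ-algebra generated by the point process (with its enumeration). -/
@[reducible] def sigma (X : PointProcess Ω E) : MeasurableSpace Ω :=
  MeasurableSpace.comap (fun ω => fun n => (X.present n ω, X.pt n ω)) inferInstance

/-- `X` is a Poisson point process with intensity measure `Λ`: the number of points in a set `B` of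
finite intensity is Poisson distributed with mean `Λ B`, and the numbers of points in pairwise
disjoint sets are independent. -/
structure IsPoisson (X : PointProcess Ω E) (Λ : Measure E) (P : Measure Ω) : Prop where
  hasLaw_count : ∀ B : Set E, MeasurableSet B → Λ B ≠ ∞ →
    HasLaw (X.count B) ((poissonMeasure (Λ B).toNNReal).map (fun n : ℕ => (n : ℝ≥0∞))) P
  iIndepFun_count : ∀ (m : ℕ) (B : Fin m → Set E), (∀ i, MeasurableSet (B i)) →
    Pairwise (fun i j => Disjoint (B i) (B j)) → iIndepFun (fun i => X.count (B i)) P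

end PointProcess

/-! ### Lines in the plane -/

/-- The intensity measure of the motion-invariant Poisson line process in its representation space:
a line is given by `(θ, y)`, with `θ ∈ [0, π)` the angle of its normal and `y` its signed distance
from the origin; lines at distance `|y| < R` are present, with density `lam` with respect to
`dθ dy`.  `R = ∞` gives the stationary process in the whole plane. -/
def lineIntensity (lam : ℝ) (R : ℝ≥0∞) : Measure (ℝ × ℝ) :=
  ENNReal.ofReal lam •
    (volume.restrict (Ico 0 Real.pi ×ˢ {y : ℝ | ENNReal.ofReal |y| < R}))

/-- The point of the line `ℓ = (θ, y)` at signed distance `t` from the foot of the perpendicular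
dropped from the origin. -/
def location (ℓ : ℝ × ℝ) (t : ℝ) : EuclideanSpace ℝ (Fin 2) :=
  !₂[ℓ.2 * Real.cos ℓ.1 - t * Real.sin ℓ.1, ℓ.2 * Real.sin ℓ.1 + t * Real.cos ℓ.1]

/-! ### The network -/

/-- Labels of the sources of randomness.  Roads are labelled by `Option ℕ`: `none` is the typical
road, which passes through the origin, and `some i` is the road number `i` of the line process. -/
inductive Source where
  | roads
  | nodes (k : Option ℕ)
  | transmits (k : Option ℕ) (j : ℕ)
  | fading (k : Option ℕ) (j : ℕ)
  | linkFading

/-- The random objects of the network seen from the typical receiver, which is at the origin. -/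
structure Network (Ω : Type*) [MeasurableSpace Ω] where
  /-- the roads other than the typical one, in the representation space -/
  roads : PointProcess Ω (ℝ × ℝ)
  /-- the angle of the normal of the typical road -/
  typicalAngle : ℝ
  /-- the positions, along road `k`, of the nodes on road `k` -/
  nodes : Option ℕ → PointProcess Ω ℝ
  /-- whether node `j` on road `k` transmits -/
  transmits : Option ℕ → ℕ → Ω → Bool
  /-- the channel gain from node `j` on road `k` to the receiver -/
  fading : Option ℕ → ℕ → Ω → ℝ
  /-- the channel gain of the link that serves the receiver -/
  linkFading : Ω → ℝ
  measurable_transmits : ∀ k j, Measurable (transmits k j)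
  measurable_fading : ∀ k j, Measurable (fading k j)
  measurable_linkFading : Measurable linkFading

namespace Network

variable {Ω : Type*} [MeasurableSpace Ω]

/-- The σ-algebra generated by a source of randomness. -/
@[reducible] def sigma (N : Network Ω) : Source → MeasurableSpace Ω
  | .roads => N.roads.sigma
  | .nodes k => (N.nodes k).sigma
  | .transmits k j => MeasurableSpace.comap (N.transmits k j) inferInstance
  | .fading k j => MeasurableSpace.comap (N.fading k j) inferInstance
  | .linkFading => MeasurableSpace.comap N.linkFading inferInstance

/-- The laws of the network: the roads form a Poisson line process of intensity `lam` (inside the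
disk of radius `R`), the nodes on each road, including the typical one, a Poisson process of
intensity `mu` on the line; each node transmits with probability `p`; all channel gains are
exponential with unit mean (Rayleigh fading); everything is independent. -/
structure IsV2X (N : Network Ω) (P : Measure Ω) (lam : ℝ) (R : ℝ≥0∞) (mu p : ℝ) : Prop where
  roads_isPoisson : N.roads.IsPoisson (lineIntensity lam R) P
  nodes_isPoisson : ∀ k, (N.nodes k).IsPoisson (ENNReal.ofReal mu • (volume : Measure ℝ)) P
  transmits_prob : ∀ k j, P {ω | N.transmits k j ω = true} = ENNReal.ofReal p
  fading_law : ∀ k j, HasLaw (N.fading k j) (expMeasure 1) P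
  linkFading_law : HasLaw N.linkFading (expMeasure 1) P
  indep : iIndep N.sigma P

/-- The line on which road `k` lies. -/
def line (N : Network Ω) (k : Option ℕ) (ω : Ω) : ℝ × ℝ :=
  match k with
  | none => (N.typicalAngle, 0)
  | some i => N.roads.pt i ω

/-- The distance from node `j` on road `k` to the receiver. -/
def dist (N : Network Ω) (k : Option ℕ) (j : ℕ) (ω : Ω) : ℝ :=
  ‖location (N.line k ω) ((N.nodes k).pt j ω)‖

/-- Given that the serving transmitter, which is the nearest one, is at distance `r`, the
interferers are the transmitting nodes outside the disk of radius `r` around the receiver. -/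
def IsInterferer (N : Network Ω) (r : ℝ) (k : Option ℕ) (j : ℕ) (ω : Ω) : Prop :=
  (N.nodes k).present j ω = true ∧ N.transmits k j ω = true ∧ r < N.dist k j ω

open Classical in
/-- The total interference `∑ Pv h D ^ (-α)` from the interferers on road `k`. -/
def roadInterference (N : Network Ω) (Pv α r : ℝ) (k : Option ℕ) (ω : Ω) : ℝ≥0∞ :=
  ∑' j, if N.IsInterferer r k j ω then
    ENNReal.ofReal (Pv * N.fading k j ω * N.dist k j ω ^ (-α)) else 0

/-- `I_r`: the interference from the road through the origin. -/
def typicalInterference (N : Network Ω) (Pv α r : ℝ) (ω : Ω) : ℝ≥0∞ :=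
  N.roadInterference Pv α r none ω

/-- `I_v`: the interference from all other roads. -/
def otherInterference (N : Network Ω) (Pv α r : ℝ) (ω : Ω) : ℝ≥0∞ :=
  ∑' i, if N.roads.present i ω = true then N.roadInterference Pv α r (some i) ω else 0

/-- The SINR at the typical receiver, served from distance `r`, with noise power `σ ^ 2`. -/
def sinr (N : Network Ω) (Pv α σ r : ℝ) (ω : Ω) : ℝ≥0∞ :=
  ENNReal.ofReal (Pv * r ^ (-α) * N.linkFading ω) /
    (N.otherInterference Pv α r ω + N.typicalInterference Pv α r ω + ENNReal.ofReal (σ ^ 2))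

/-- The success probability `P(SINR > z)` for the link distance `r`. -/
def successProb (N : Network Ω) (P : Measure Ω) (Pv α σ z r : ℝ) : ℝ :=
  P.real {ω | ENNReal.ofReal z < N.sinr Pv α σ r ω}

end Network

/-! ### Laplace transforms -/

/-- `exp (-x)` for `x ∈ [0, ∞]`, with `exp (-∞) = 0`. -/
def expNeg (x : ℝ≥0∞) : ℝ := if x = ∞ then 0 else Real.exp (-x.toReal)

/-- The Laplace transform `E[exp (-s I)]` of a random variable `I` with values in `[0, ∞]`. -/
def laplace {Ω : Type*} [MeasurableSpace Ω] (P : Measure Ω) (I : Ω → ℝ≥0∞) (s : ℝ) : ℝ :=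
  ∫ ω, expNeg (ENNReal.ofReal s * I ω) ∂P

/-- The Laplace transform of the interference from one road at distance `y < r` of the origin,
with interferers of intensity `mu` outside the disk of radius `r`. -/
def laplaceIn (mu Pv α r s y : ℝ) : ℝ :=
  Real.exp (-2 * mu * ∫ t in Ioi (√(r ^ 2 - y ^ 2)),
    (1 - 1 / (1 + s * Pv * (y ^ 2 + t ^ 2) ^ (-α / 2))))

/-- The Laplace transform of the interference from one road at distance `y > r` of the origin,
with interferers of intensity `mu`. -/
def laplaceOut (mu Pv α s y : ℝ) : ℝ :=
  Real.exp (-2 * mu * ∫ t in Ioi (0 : ℝ),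
    (1 - 1 / (1 + s * Pv * (y ^ 2 + t ^ 2) ^ (-α / 2))))

/-- The Gauss hypergeometric function `₂F₁(a, b; c; x)` for real `x < 1` and `c > b > 0`, through
Euler's integral (its standard analytic continuation from the disk of convergence of the power
series). -/
def hyp2F1 (a b c x : ℝ) : ℝ :=
  Real.Gamma c / (Real.Gamma b * Real.Gamma (c - b)) *
    ∫ t in Ioo (0 : ℝ) 1, t ^ (b - 1) * (1 - t) ^ (c - b - 1) * (1 - x * t) ^ (-a)

end

end V2X

/-! The serving gain is unit exponential and independent of the interference, so conditioning on the
interference turns the success probability into the mean of exp(-s(I_v + I_r + σ²)). This factors,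
because I_v and I_r are built from disjoint sets of independent sources (`successProb_eq`). Both
transforms come from the Laplace functional of an independently marked Poisson process,
`lintegral_ennExpNeg_tsum_marked`: E exp(-∑ F(x, mark)) = exp(-∫ (1 - ψ) dΛ), where ψ(x) is the mean
of exp(-F(x, mark)). It is used at two nested levels. On a fixed road the points are the nodes, and
a mark is a decision together with a gain. For I_v the points are the roads, the mark of a road is
all the data on it, and ψ is the one-road transform found at the inner level. The rest is calculus:
reflection symmetry gives the factors 2, the angle gives π (`lintegral_lineIntensity`), and a power
substitution gives Euler's integral (`integral_attenuation_eq_hyp2F1`). The probabilistic part takes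
values in [0, ∞], where sums and exponentials need no convergence hypothesis. -/

namespace V2X

noncomputable section

/-! ### The decreasing exponential on `[0, ∞]` -/

/-- `exp (-x)` as a function from `[0, ∞]` to `[0, ∞]`. -/
def ennExpNeg (x : ℝ≥0∞) : ℝ≥0∞ := EReal.exp (-(x : EReal))

lemma continuous_ennExpNeg : Continuous ennExpNeg :=
  ENNReal.continuous_exp.comp (continuous_neg.comp continuous_coe_ennreal_ereal)

@[fun_prop]
lemma measurable_ennExpNeg : Measurable ennExpNeg := continuous_ennExpNeg.measurable

@[simp]
lemma ennExpNeg_zero : ennExpNeg 0 = 1 := by simp [ennExpNeg]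

@[simp]
lemma ennExpNeg_top : ennExpNeg ∞ = 0 := by simp [ennExpNeg]

lemma ennExpNeg_ofReal {x : ℝ} (hx : 0 ≤ x) :
    ennExpNeg (ENNReal.ofReal x) = ENNReal.ofReal (Real.exp (-x)) := by
  rw [ennExpNeg, EReal.coe_ennreal_ofReal, max_eq_left hx, ← EReal.coe_neg, EReal.exp_coe]

lemma ennExpNeg_add (x y : ℝ≥0∞) : ennExpNeg (x + y) = ennExpNeg x * ennExpNeg y := by
  simp only [ennExpNeg]
  rw [← EReal.exp_add, EReal.coe_ennreal_add, EReal.neg_add (by simp) (by simp), sub_eq_add_neg]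

lemma ennExpNeg_sum {ι : Type*} (s : Finset ι) (f : ι → ℝ≥0∞) :
    ennExpNeg (∑ i ∈ s, f i) = ∏ i ∈ s, ennExpNeg (f i) := by
  classical
  induction s using Finset.induction_on with
  | empty => simp
  | insert a s ha ih => rw [Finset.sum_insert ha, Finset.prod_insert ha, ennExpNeg_add, ih]

lemma ennExpNeg_nat_mul (n : ℕ) (x : ℝ≥0∞) : ennExpNeg (x * n) = ennExpNeg x ^ n := by
  rw [mul_comm]
  simpa using ennExpNeg_sum (Finset.range n) (fun _ => x)

lemma antitone_ennExpNeg : Antitone ennExpNeg := fun _ _ h =>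
  EReal.exp_monotone (EReal.neg_le_neg_iff.2 (EReal.coe_ennreal_le_coe_ennreal_iff.2 h))

lemma ennExpNeg_le_one (x : ℝ≥0∞) : ennExpNeg x ≤ 1 := by
  simpa using antitone_ennExpNeg (zero_le (a := x))

lemma ofReal_expNeg (x : ℝ≥0∞) : ENNReal.ofReal (expNeg x) = ennExpNeg x := by
  rcases eq_or_ne x ∞ with rfl | hx
  · simp [expNeg]
  · rw [expNeg, if_neg hx, ← ennExpNeg_ofReal ENNReal.toReal_nonneg, ENNReal.ofReal_toReal hx]

lemma expNeg_eq_toReal (x : ℝ≥0∞) : expNeg x = (ennExpNeg x).toReal := by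
  rw [← ofReal_expNeg, ENNReal.toReal_ofReal]
  unfold expNeg
  split_ifs <;> positivity

/-- The inverse of `ennExpNeg` on `[0, 1]`. -/
def ennNegLog (q : ℝ≥0∞) : ℝ≥0∞ := (-(ENNReal.log q)).toENNReal

@[fun_prop]
lemma measurable_ennNegLog : Measurable ennNegLog :=
  measurable_ereal_toENNReal.comp (continuous_neg.measurable.comp ENNReal.measurable_log)

/-- Any mean ψ ≤ 1 over a mark, possibly 0, thus becomes exp(-g) for some g with values in [0, ∞],
so marks can be absorbed into an unmarked functional. -/
lemma ennExpNeg_ennNegLog {q : ℝ≥0∞} (hq : q ≤ 1) : ennExpNeg (ennNegLog q) = q := by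
  have h : 0 ≤ -(ENNReal.log q) := by
    rw [EReal.neg_nonneg]
    exact ENNReal.log_le_zero_iff.2 hq
  rw [ennExpNeg, ennNegLog, EReal.coe_toENNReal h, neg_neg, ENNReal.exp_log]

lemma tendsto_ennExpNeg_sum_range (f : ℕ → ℝ≥0∞) :
    Filter.Tendsto (fun n => ∏ i ∈ Finset.range n, ennExpNeg (f i)) Filter.atTop
      (nhds (ennExpNeg (∑' i, f i))) := by
  simp_rw [← ennExpNeg_sum]
  exact (continuous_ennExpNeg.tendsto _).comp (ENNReal.tendsto_nat_tsum f)

lemma laplace_eq_toReal {Ω : Type*} [MeasurableSpace Ω] {P : Measure Ω} {I : Ω → ℝ≥0∞}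
    (hI : Measurable I) (s : ℝ) :
    laplace P I s = (∫⁻ ω, ennExpNeg (ENNReal.ofReal s * I ω) ∂P).toReal := by
  simp_rw [laplace, expNeg_eq_toReal]
  refine integral_toReal (by fun_prop) (Filter.Eventually.of_forall fun ω => ?_)
  exact (ennExpNeg_le_one _).trans_lt ENNReal.one_lt_top

/-! ### Independence of blocks -/

/-- Induction on the number of blocks: a new block is independent of the union of the earlier ones
by the two-block statement `indep_iSup_of_disjoint`. -/
lemma iIndep_iSup_blocks {Ω ι κ : Type*} {mΩ : MeasurableSpace Ω} {P : Measure Ω}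
    {m : ι → MeasurableSpace Ω} (hm : ∀ i, m i ≤ mΩ) (h : iIndep m P) {S : κ → Set ι}
    (hS : Pairwise (fun i j => Disjoint (S i) (S j))) :
    iIndep (fun k => ⨆ i ∈ S k, m i) P := by
  classical
  have := h.isProbabilityMeasure
  rw [iIndep_iff]
  intro s f hf
  induction s using Finset.induction_on with
  | empty => simp
  | insert a s ha ih =>
    rw [Finset.set_biInter_insert, Finset.prod_insert ha,
      ← ih (fun i hi => hf i (Finset.mem_insert_of_mem hi))]
    have hdisj : Disjoint (S a) (⋃ k ∈ s, S k) := by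
      simp only [disjoint_iUnion_right]
      intro k hk
      exact hS (by rintro rfl; exact ha hk)
    refine (Indep_iff _ _ _).1 (indep_iSup_of_disjoint hm h hdisj) _ _
      (hf a (Finset.mem_insert_self a s)) ?_
    refine Finset.measurableSet_biInter s fun k hk => ?_
    have hle : (⨆ i ∈ S k, m i) ≤ ⨆ i ∈ ⋃ k ∈ s, S k, m i :=
      biSup_mono fun i hi => mem_biUnion (Finset.mem_coe.2 hk) hi
    exact hle _ (hf k (Finset.mem_insert_of_mem hk))

/-- Products over marks that are independent of each other and of a common random element. -/
lemma lintegral_ennExpNeg_tsum_marks {Ω A B : Type*} [MeasurableSpace Ω] [MeasurableSpace A]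
    [MeasurableSpace B] {P : Measure Ω} [IsProbabilityMeasure P] {X : Ω → A} {Y : ℕ → Ω → B}
    (hX : Measurable X) (hY : ∀ j, Measurable (Y j))
    (hXY : IndepFun X (fun ω j => Y j ω) P) (hind : iIndepFun Y P)
    {F : ℕ → A × B → ℝ≥0∞} (hF : ∀ j, Measurable (F j)) {G : ℕ → A → ℝ≥0∞}
    (hG : ∀ j, Measurable (G j))
    (hFG : ∀ j a, ∫⁻ ω, ennExpNeg (F j (a, Y j ω)) ∂P = ennExpNeg (G j a)) :
    ∫⁻ ω, ennExpNeg (∑' j, F j (X ω, Y j ω)) ∂P = ∫⁻ ω, ennExpNeg (∑' j, G j (X ω)) ∂P := by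
  have hYm : Measurable (fun ω j => Y j ω) := measurable_pi_iff.2 hY
  have hfin : ∀ n : ℕ, ∫⁻ ω, ∏ j ∈ Finset.range n, ennExpNeg (F j (X ω, Y j ω)) ∂P =
      ∫⁻ ω, ∏ j ∈ Finset.range n, ennExpNeg (G j (X ω)) ∂P := by
    intro n
    have hmap := (indepFun_iff_map_prod_eq_prod_map_map hX.aemeasurable hYm.aemeasurable).1 hXY
    have hm : Measurable (fun q : A × (ℕ → B) =>
        ∏ j ∈ Finset.range n, ennExpNeg (F j (q.1, q.2 j))) := by fun_prop
    have hm' : Measurable (fun a : A =>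
        ∏ j ∈ Finset.range n, ennExpNeg (G j a)) := by fun_prop
    have h1 := lintegral_map (μ := P) hm (hX.prodMk hYm)
    have : IsProbabilityMeasure (P.map X) := Measure.isProbabilityMeasure_map hX.aemeasurable
    have : IsProbabilityMeasure (P.map fun ω j => Y j ω) :=
      Measure.isProbabilityMeasure_map hYm.aemeasurable
    -- Independence makes the joint law a product, so Fubini allows `X` to be frozen at `a`; the
    -- mean over the marks then splits into factors.
    rw [hmap, lintegral_prod _ hm.aemeasurable] at h1
    rw [← h1, ← lintegral_map hm' hX]
    refine lintegral_congr fun a => ?_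
    rw [lintegral_map (by fun_prop) hYm]
    rw [lintegral_prod_eq_prod_lintegral_of_indepFun (Finset.range n)
      (fun j ω => ennExpNeg (F j (a, Y j ω)))
      (hind.comp (fun j b => ennExpNeg (F j (a, b))) (fun j => by fun_prop))
      (fun j => by fun_prop)]
    simp_rw [hFG]
  have hprod : ∀ (n : ℕ) (f : ℕ → ℝ≥0∞), ∏ j ∈ Finset.range n, ennExpNeg (f j) ≤ 1 :=
    fun n f => Finset.prod_le_one' fun j _ => ennExpNeg_le_one _
  have hL : Filter.Tendsto (fun n => ∫⁻ ω, ∏ j ∈ Finset.range n, ennExpNeg (F j (X ω, Y j ω)) ∂P)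
      Filter.atTop (nhds (∫⁻ ω, ennExpNeg (∑' j, F j (X ω, Y j ω)) ∂P)) := by
    refine tendsto_lintegral_of_dominated_convergence (fun _ => 1) (fun n => by fun_prop)
      (fun n => Filter.Eventually.of_forall fun ω => hprod n _) (by simp)
      (Filter.Eventually.of_forall fun ω => tendsto_ennExpNeg_sum_range _)
  have hR : Filter.Tendsto (fun n => ∫⁻ ω, ∏ j ∈ Finset.range n, ennExpNeg (G j (X ω)) ∂P)
      Filter.atTop (nhds (∫⁻ ω, ennExpNeg (∑' j, G j (X ω)) ∂P)) := by
    refine tendsto_lintegral_of_dominated_convergence (fun _ => 1) (fun n => by fun_prop)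
      (fun n => Filter.Eventually.of_forall fun ω => hprod n _) (by simp)
      (Filter.Eventually.of_forall fun ω => tendsto_ennExpNeg_sum_range _)
  simp_rw [hfin] at hL
  exact tendsto_nhds_unique hL hR

/-! ### The Laplace functional of a Poisson point process -/

/-- This is the exponential series for m q. The bound `hq` keeps the truncated subtraction `1 - q`
honest. -/
lemma lintegral_pow_poissonMeasure (m : NNReal) {q : ℝ≥0∞} (hq : q ≤ 1) :
    ∫⁻ n, q ^ n ∂(poissonMeasure m) = ennExpNeg ((1 - q) * m) := by
  have hq' : q ≠ ∞ := (hq.trans_lt ENNReal.one_lt_top).ne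
  lift q to NNReal using hq'
  have hq1 : (q : ℝ) ≤ 1 := by exact_mod_cast hq
  have hs : HasSum (fun n : ℕ => Real.exp (-m) * (m * q : ℝ) ^ n / n.factorial)
      (Real.exp (-m) * Real.exp (m * q)) := by
    have := (NormedSpace.expSeries_div_hasSum_exp (m * q : ℝ)).mul_left (Real.exp (-m))
    simpa [← Real.exp_eq_exp_ℝ, mul_div_assoc] using this
  have hr : (1 - (q : ℝ≥0∞)) * m = ENNReal.ofReal ((1 - q) * m) := by
    rw [ENNReal.ofReal_mul (by linarith), ENNReal.ofReal_sub _ q.coe_nonneg]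
    simp
  rw [hr, ennExpNeg_ofReal (mul_nonneg (by linarith) m.coe_nonneg), poissonMeasure, lintegral_sum_measure]
  have : Real.exp (-((1 - (q : ℝ)) * m)) = Real.exp (-m) * Real.exp (m * q) := by
    rw [← Real.exp_add]; ring_nf
  rw [this, ← hs.tsum_eq, ENNReal.ofReal_tsum_of_nonneg (fun n => by positivity) hs.summable]
  refine tsum_congr fun n => ?_
  rw [lintegral_smul_measure, lintegral_dirac, smul_eq_mul,
    ← ENNReal.ofReal_coe_nnreal (p := q), ← ENNReal.ofReal_pow q.coe_nonneg,
    ← ENNReal.ofReal_mul (by positivity)]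
  congr 1
  rw [mul_pow]; ring

namespace PointProcess

variable {Ω E : Type*} [MeasurableSpace Ω] [MeasurableSpace E]

/-- The data of the enumeration of a point process. -/
def data (X : PointProcess Ω E) (ω : Ω) : ℕ → Bool × E := fun n => (X.present n ω, X.pt n ω)

lemma measurable_data (X : PointProcess Ω E) : Measurable X.data :=
  measurable_pi_iff.2 fun n => (X.measurable_present n).prodMk (X.measurable_pt n)

/-- The sum of `g` over the points. -/
def sum (X : PointProcess Ω E) (g : E → ℝ≥0∞) (ω : Ω) : ℝ≥0∞ :=
  ∑' n, if X.present n ω = true then g (X.pt n ω) else 0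

lemma measurableSet_present (X : PointProcess Ω E) (n : ℕ) :
    MeasurableSet {ω | X.present n ω = true} :=
  X.measurable_present n (measurableSet_singleton true)

lemma measurable_sum (X : PointProcess Ω E) {g : E → ℝ≥0∞} (hg : Measurable g) :
    Measurable (X.sum g) :=
  Measurable.tsum fun n =>
    Measurable.ite (X.measurableSet_present n) (hg.comp (X.measurable_pt n)) measurable_const

lemma count_eq_sum (X : PointProcess Ω E) (B : Set E) :
    X.count B = X.sum (B.indicator fun _ => 1) := by
  classical
  ext ω
  refine tsum_congr fun n => ?_
  by_cases h : X.present n ω = true <;> by_cases h' : X.pt n ω ∈ B <;> simp [h, h']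

lemma measurable_count (X : PointProcess Ω E) {B : Set E} (hB : MeasurableSet B) :
    Measurable (X.count B) := by
  rw [count_eq_sum]
  exact X.measurable_sum (measurable_const.indicator hB)

lemma sum_simpleFunc (X : PointProcess Ω E) (f : SimpleFunc E ℝ≥0∞) (ω : Ω) :
    X.sum f ω = ∑ c ∈ f.range, c * X.count (f ⁻¹' {c}) ω := by
  classical
  simp_rw [count_eq_sum, sum, ← ENNReal.tsum_mul_left]
  rw [← Summable.tsum_finsetSum (fun _ _ => ENNReal.summable)]
  refine tsum_congr fun n => ?_
  by_cases h : X.present n ω = true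
  · simp only [h, if_true]
    rw [Finset.sum_eq_single_of_mem (f (X.pt n ω)) (f.mem_range_self _)]
    · simp
    · intro c _ hc
      have : X.pt n ω ∉ f ⁻¹' {c} := fun hx => hc (by simpa using hx.symm)
      simp [indicator_of_notMem this]
  · simp [h]

namespace IsPoisson

variable {X : PointProcess Ω E} {Λ : Measure E} {P : Measure Ω}

lemma lintegral_ennExpNeg_mul_count (h : X.IsPoisson Λ P) {B : Set E} (hB : MeasurableSet B)
    (hΛ : Λ B ≠ ∞) (c : ℝ≥0∞) :
    ∫⁻ ω, ennExpNeg (c * X.count B ω) ∂P = ennExpNeg ((1 - ennExpNeg c) * Λ B) := by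
  have hlaw := h.hasLaw_count B hB hΛ
  have hm : Measurable fun x : ℝ≥0∞ => ennExpNeg (c * x) := by fun_prop
  rw [← lintegral_map (μ := P) hm (X.measurable_count hB), hlaw.map_eq,
    lintegral_map hm (by fun_prop)]
  simp_rw [ennExpNeg_nat_mul]
  rw [lintegral_pow_poissonMeasure _ (ennExpNeg_le_one c), ENNReal.coe_toNNReal hΛ]

/-- The sum is a combination of the counts of the level sets, which are disjoint, so the counts are
independent. The level 0 may have infinite intensity, but it contributes nothing to either side. -/
lemma lintegral_ennExpNeg_sum_simpleFunc [IsProbabilityMeasure P] (h : X.IsPoisson Λ P)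
    (f : SimpleFunc E ℝ≥0∞) (hf : ∀ c, c ≠ 0 → Λ (f ⁻¹' {c}) ≠ ∞) :
    ∫⁻ ω, ennExpNeg (X.sum f ω) ∂P = ennExpNeg (∫⁻ x, (1 - ennExpNeg (f x)) ∂Λ) := by
  have hR : ∫⁻ x, (1 - ennExpNeg (f x)) ∂Λ
      = ∑ c ∈ f.range, (1 - ennExpNeg c) * Λ (f ⁻¹' {c}) := by
    rw [← SimpleFunc.map_lintegral (fun c => 1 - ennExpNeg c) f, ← SimpleFunc.lintegral_eq_lintegral]
    rfl
  rw [hR, ennExpNeg_sum]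
  simp_rw [sum_simpleFunc, ennExpNeg_sum]
  have hc : ∀ c, ∫⁻ ω, ennExpNeg (c * X.count (f ⁻¹' {c}) ω) ∂P =
      ennExpNeg ((1 - ennExpNeg c) * Λ (f ⁻¹' {c})) := by
    intro c
    rcases eq_or_ne c 0 with rfl | hc
    · simp
    · exact h.lintegral_ennExpNeg_mul_count (f.measurableSet_fiber c) (hf c hc) c
  simp_rw [← hc]
  -- `iIndepFun_count` speaks of families indexed by `Fin m`, so the values of `f` are numbered.
  let e := f.range.equivFin
  have hprod : ∀ u : ℝ≥0∞ → ℝ≥0∞, ∏ c ∈ f.range, u c = ∏ i, u (e.symm i) := by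
    intro u
    rw [← Finset.prod_coe_sort]
    exact (Equiv.prod_comp e.symm (fun c : f.range => u c)).symm
  simp_rw [hprod]
  have hind := h.iIndepFun_count _ (fun i => f ⁻¹' {(e.symm i : ℝ≥0∞)})
    (fun i => f.measurableSet_fiber _) (fun i j hij => by
      refine Disjoint.preimage _ (disjoint_singleton.2 fun hc => hij ?_)
      exact e.symm.injective (Subtype.ext hc))
  exact lintegral_prod_eq_prod_lintegral_of_indepFun Finset.univ
    (fun i ω => ennExpNeg ((e.symm i : ℝ≥0∞) * X.count (f ⁻¹' {(e.symm i : ℝ≥0∞)}) ω))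
    (hind.comp (fun i x => ennExpNeg ((e.symm i : ℝ≥0∞) * x)) (fun i => by fun_prop))
    (fun i => by have := X.measurable_count (f.measurableSet_fiber (e.symm i : ℝ≥0∞)); fun_prop)

/-- The Laplace functional of a Poisson point process. -/
theorem lintegral_ennExpNeg_sum [IsProbabilityMeasure P] [SigmaFinite Λ] (h : X.IsPoisson Λ P)
    {g : E → ℝ≥0∞} (hg : Measurable g) :
    ∫⁻ ω, ennExpNeg (X.sum g ω) ∂P = ennExpNeg (∫⁻ x, (1 - ennExpNeg (g x)) ∂Λ) := by
  -- Cutting off to the spanning sets gives every nonzero level finite intensity.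
  let f : ℕ → SimpleFunc E ℝ≥0∞ := fun n => (SimpleFunc.eapprox g n).restrict (spanningSets Λ n)
  have hfv : ∀ n x, f n x = (spanningSets Λ n).indicator (SimpleFunc.eapprox g n) x := fun n x =>
    by rw [SimpleFunc.restrict_apply _ (measurableSet_spanningSets Λ n)]
  have hmono : ∀ x, Monotone fun n => f n x := by
    intro x i j hij
    simp only [hfv]
    refine (indicator_le_indicator (SimpleFunc.monotone_eapprox g hij x)).trans ?_
    exact indicator_le_indicator_of_subset (monotone_spanningSets Λ hij) (fun _ => zero_le) x
  have hlim : ∀ x, Filter.Tendsto (fun n => f n x) Filter.atTop (nhds (g x)) := by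
    intro x
    refine (SimpleFunc.tendsto_eapprox hg x).congr' ?_
    obtain ⟨N, hN⟩ : ∃ N, x ∈ spanningSets Λ N := by
      have := mem_univ x
      rwa [← iUnion_spanningSets Λ, mem_iUnion] at this
    filter_upwards [Filter.eventually_ge_atTop N] with n hn
    rw [hfv, indicator_of_mem (monotone_spanningSets Λ hn hN)]
  have hfin : ∀ n c, c ≠ 0 → Λ (f n ⁻¹' {c}) ≠ ∞ := by
    intro n c hc
    refine ((measure_mono ?_).trans_lt (measure_spanningSets_lt_top Λ n)).ne
    intro x hx
    by_contra hx'
    have : f n x = c := hx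
    rw [hfv, indicator_of_notMem hx'] at this
    exact hc this.symm
  have hsum : ∀ ω, Filter.Tendsto (fun n => X.sum (f n) ω) Filter.atTop (nhds (X.sum g ω)) := by
    intro ω
    simp only [sum, ← lintegral_count]
    refine lintegral_tendsto_of_tendsto_of_monotone (fun n => by fun_prop)
      (Filter.Eventually.of_forall fun k i j hij => ?_) (Filter.Eventually.of_forall fun k => ?_)
    · dsimp only
      split_ifs
      · exact hmono _ hij
      · exact le_rfl
    · split_ifs
      · exact hlim _
      · exact tendsto_const_nhds
  have hL : Filter.Tendsto (fun n => ∫⁻ ω, ennExpNeg (X.sum (f n) ω) ∂P) Filter.atTop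
      (nhds (∫⁻ ω, ennExpNeg (X.sum g ω) ∂P)) :=
    tendsto_lintegral_of_dominated_convergence (fun _ => 1)
      (fun n => measurable_ennExpNeg.comp (X.measurable_sum (f n).measurable))
      (fun n => Filter.Eventually.of_forall fun ω => ennExpNeg_le_one _) (by simp)
      (Filter.Eventually.of_forall fun ω => (continuous_ennExpNeg.tendsto _).comp (hsum ω))
  -- `Λ` may be infinite, so the bound 1 does not dominate here; monotone convergence is used
  -- instead.
  have hR : Filter.Tendsto (fun n => ∫⁻ x, (1 - ennExpNeg (f n x)) ∂Λ) Filter.atTop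
      (nhds (∫⁻ x, (1 - ennExpNeg (g x)) ∂Λ)) := by
    refine lintegral_tendsto_of_tendsto_of_monotone (fun n => ?_)
      (Filter.Eventually.of_forall fun x i j hij => ?_) (Filter.Eventually.of_forall fun x => ?_)
    · have := (f n).measurable
      fun_prop
    · exact tsub_le_tsub_left (antitone_ennExpNeg (hmono x hij)) _
    · exact ENNReal.Tendsto.sub tendsto_const_nhds
        ((continuous_ennExpNeg.tendsto _).comp (hlim x)) (Or.inl ENNReal.one_ne_top)
  refine tendsto_nhds_unique hL ?_
  simp_rw [fun n => h.lintegral_ennExpNeg_sum_simpleFunc (f n) (hfin n)]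
  exact (continuous_ennExpNeg.tendsto _).comp hR

/-- The Laplace functional of an independently marked Poisson point process. -/
theorem lintegral_ennExpNeg_tsum_marked [IsProbabilityMeasure P] [SigmaFinite Λ]
    (h : X.IsPoisson Λ P) {B : Type*} [MeasurableSpace B] {Y : ℕ → Ω → B}
    (hY : ∀ j, Measurable (Y j)) (hXY : IndepFun X.data (fun ω j => Y j ω) P)
    (hind : iIndepFun Y P) {F : E × B → ℝ≥0∞} (hF : Measurable F) {ψ : E → ℝ≥0∞}
    (hψ : ∀ j x, ∫⁻ ω, ennExpNeg (F (x, Y j ω)) ∂P = ψ x) :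
    ∫⁻ ω, ennExpNeg (∑' j, if X.present j ω = true then F (X.pt j ω, Y j ω) else 0) ∂P =
      ennExpNeg (∫⁻ x, (1 - ψ x) ∂Λ) := by
  have hψm : Measurable ψ := by
    have : ψ = fun x => ∫⁻ ω, ennExpNeg (F (x, Y 0 ω)) ∂P := funext fun x => (hψ 0 x).symm
    rw [this]
    have := hY 0
    exact Measurable.lintegral_prod_right' (f := fun q : E × Ω => ennExpNeg (F (q.1, Y 0 q.2)))
      (by fun_prop)
  have hψ1 : ∀ x, ψ x ≤ 1 := by
    intro x
    rw [← hψ 0 x]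
    calc ∫⁻ ω, ennExpNeg (F (x, Y 0 ω)) ∂P ≤ ∫⁻ _, 1 ∂P :=
          lintegral_mono fun ω => ennExpNeg_le_one _
      _ = 1 := by simp
  have hpres : ∀ j, MeasurableSet {d : ℕ → Bool × E | (d j).1 = true} := fun j =>
    (measurable_fst.comp (measurable_pi_apply j)) (measurableSet_singleton true)
  -- Averaging out the marks replaces `F` by `ennNegLog ∘ ψ`, a function of the point alone.
  have key := lintegral_ennExpNeg_tsum_marks X.measurable_data hY hXY hind
    (F := fun j q => if (q.1 j).1 = true then F ((q.1 j).2, q.2) else 0)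
    (G := fun j d => if (d j).1 = true then ennNegLog (ψ (d j).2) else 0)
    (fun j => Measurable.ite (measurable_fst (hpres j)) (by fun_prop) measurable_const)
    (fun j => Measurable.ite (hpres j) (by fun_prop) measurable_const)
    (fun j d => by
      by_cases hd : (d j).1 = true
      · simp only [hd, if_true]
        rw [hψ, ennExpNeg_ennNegLog (hψ1 _)]
      · simp [hd])
  refine key.trans ?_
  have := h.lintegral_ennExpNeg_sum (g := fun x => ennNegLog (ψ x)) (by fun_prop)
  simp_rw [fun x => ennExpNeg_ennNegLog (hψ1 x)] at this
  exact this

end IsPoisson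

end PointProcess

lemma sigmaFinite_ofReal_smul {E : Type*} [MeasurableSpace E] (c : ℝ) (Λ : Measure E)
    [SigmaFinite Λ] : SigmaFinite (ENNReal.ofReal c • Λ) :=
  inferInstanceAs (SigmaFinite (c.toNNReal • Λ))

/-! ### Exponential distributions -/

/-- Tilting the unit exponential density by exp(-c x) gives 1 / (1 + c) times the density of rate 1
+ c. -/
lemma lintegral_ennExpNeg_mul_expMeasure {c : ℝ} (hc : 0 ≤ c) :
    ∫⁻ x, ennExpNeg (ENNReal.ofReal (c * x)) ∂(expMeasure 1) = ENNReal.ofReal (1 / (1 + c)) := by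
  have hm : Measurable (exponentialPDF 1) := (measurable_exponentialPDFReal 1).ennreal_ofReal
  have hm' : Measurable (exponentialPDF (1 + c)) :=
    (measurable_exponentialPDFReal (1 + c)).ennreal_ofReal
  have hw : expMeasure 1 = volume.withDensity (exponentialPDF 1) := rfl
  rw [hw, lintegral_withDensity_eq_lintegral_mul _ hm (by fun_prop)]
  have : ∀ x, (exponentialPDF 1 * fun x => ennExpNeg (ENNReal.ofReal (c * x))) x =
      ENNReal.ofReal (1 / (1 + c)) * exponentialPDF (1 + c) x := by
    intro x
    rcases lt_or_ge x 0 with hx | hx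
    · simp [exponentialPDF_of_neg hx]
    · rw [Pi.mul_apply, exponentialPDF_of_nonneg hx, exponentialPDF_of_nonneg hx,
        ennExpNeg_ofReal (mul_nonneg hc hx), ← ENNReal.ofReal_mul (by positivity),
        ← ENNReal.ofReal_mul (by positivity), one_mul, ← Real.exp_add]
      congr 1
      rw [← mul_assoc, one_div_mul_cancel (by positivity), one_mul]
      ring_nf
  simp_rw [this]
  rw [lintegral_const_mul _ hm', lintegral_exponentialPDF_eq_one (by positivity), mul_one]

lemma expMeasure_one_Ioi {a : ℝ} (ha : 0 ≤ a) :
    expMeasure 1 (Ioi a) = ENNReal.ofReal (Real.exp (-a)) := by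
  have : IsProbabilityMeasure (expMeasure 1) := isProbabilityMeasure_expMeasure one_pos
  have h := cdf_expMeasure_eq one_pos a
  rw [cdf_eq_real, if_pos ha, one_mul] at h
  rw [← compl_Iic, ← ofReal_measureReal, probReal_compl_eq_one_sub measurableSet_Iic, h,
    sub_sub_cancel]

/-- The distance to the origin of a point of a line at distance `|y|`. -/
lemma norm_location (ℓ : ℝ × ℝ) (t : ℝ) : ‖location ℓ t‖ = √(ℓ.2 ^ 2 + t ^ 2) := by
  rw [EuclideanSpace.norm_eq]
  congr 1
  simp only [location, Fin.sum_univ_two, Real.norm_eq_abs, sq_abs]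
  simp
  nlinarith [Real.sin_sq_add_cos_sq ℓ.1]

/-! ### Interference as a function of the road and of the data on it -/

/-- The data on a road: presence and position of each node, its decision to transmit, its gain. -/
abbrev RoadData : Type := (ℕ → Bool × ℝ) × (ℕ → Bool × ℝ)

open Classical in
/-- The contribution of a node, with position `q.1`, decision `q.2.1` and gain `q.2.2`, to the
interference. -/
def nodeInterference (Pv α r : ℝ) (ℓ : ℝ × ℝ) (q : ℝ × (Bool × ℝ)) : ℝ≥0∞ :=
  if q.2.1 = true ∧ r < √(ℓ.2 ^ 2 + q.1 ^ 2) then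
    ENNReal.ofReal (Pv * q.2.2 * √(ℓ.2 ^ 2 + q.1 ^ 2) ^ (-α)) else 0

/-- The interference from the road `ℓ` with data `d`. -/
def lineInterference (Pv α r : ℝ) (ℓ : ℝ × ℝ) (d : RoadData) : ℝ≥0∞ :=
  ∑' j, if (d.1 j).1 = true then nodeInterference Pv α r ℓ ((d.1 j).2, d.2 j) else 0

lemma measurable_nodeInterference (Pv α r : ℝ) :
    Measurable fun q : (ℝ × ℝ) × (ℝ × (Bool × ℝ)) => nodeInterference Pv α r q.1 q.2 := by
  classical
  have h : Measurable fun q : (ℝ × ℝ) × (ℝ × (Bool × ℝ)) => √(q.1.2 ^ 2 + q.2.1 ^ 2) := by fun_prop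
  refine Measurable.ite (.inter ?_ (measurableSet_lt measurable_const h)) ?_ measurable_const
  · exact (measurable_fst.comp (measurable_snd.comp measurable_snd)) (measurableSet_singleton true)
  · fun_prop

lemma measurable_lineInterference (Pv α r : ℝ) :
    Measurable fun q : (ℝ × ℝ) × RoadData => lineInterference Pv α r q.1 q.2 := by
  refine Measurable.tsum fun j => Measurable.ite ?_ ?_ measurable_const
  · have : Measurable fun q : (ℝ × ℝ) × RoadData => (q.2.1 j).1 := by fun_prop
    exact this (measurableSet_singleton true)
  · have : Measurable fun q : (ℝ × ℝ) × RoadData => (q.1, ((q.2.1 j).2, q.2.2 j)) := by fun_prop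
    exact (measurable_nodeInterference Pv α r).comp this

/-- The mean of `exp (-s J)` for the contribution `J` of a node at position `t` on the road `ℓ`. -/
def nodeLaplace (p Pv α r s : ℝ) (ℓ : ℝ × ℝ) (t : ℝ) : ℝ :=
  if r < √(ℓ.2 ^ 2 + t ^ 2) then
    1 - p * (1 - 1 / (1 + s * Pv * √(ℓ.2 ^ 2 + t ^ 2) ^ (-α))) else 1

namespace Network

variable {Ω : Type*} [MeasurableSpace Ω] (N : Network Ω)

/-- The decisions to transmit and the gains on the road `k`. -/
def marks (k : Option ℕ) (j : ℕ) (ω : Ω) : Bool × ℝ := (N.transmits k j ω, N.fading k j ω)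

/-- All the data on the road `k`. -/
def roadData (k : Option ℕ) (ω : Ω) : RoadData := ((N.nodes k).data ω, fun j => N.marks k j ω)

/-! ### Measurability and independence through disjoint sets of sources -/

lemma sigma_le (i : Source) : N.sigma i ≤ ‹MeasurableSpace Ω› := by
  cases i with
  | roads => exact (N.roads.measurable_data).comap_le
  | nodes k => exact ((N.nodes k).measurable_data).comap_le
  | transmits k j => exact (N.measurable_transmits k j).comap_le
  | fading k j => exact (N.measurable_fading k j).comap_le
  | linkFading => exact N.measurable_linkFading.comap_le

/-- The sources of the marks of node `j` on road `k`. -/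
def markSources (k : Option ℕ) (j : ℕ) : Set Source := {.transmits k j, .fading k j}

/-- The sources of the marks on road `k`. -/
def marksSources (k : Option ℕ) : Set Source := ⋃ j, markSources k j

/-- The sources of the data on road `k`. -/
def roadSources (k : Option ℕ) : Set Source := insert (.nodes k) (marksSources k)

/-- The σ-algebra generated by a set of sources. -/
abbrev sourcesSigma (S : Set Source) : MeasurableSpace Ω := ⨆ i ∈ S, N.sigma i

lemma sourcesSigma_mono {S T : Set Source} (h : S ⊆ T) : N.sourcesSigma S ≤ N.sourcesSigma T :=
  biSup_mono fun _ hi => h hi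

lemma sourcesSigma_le (S : Set Source) :
    N.sourcesSigma S ≤ ‹MeasurableSpace Ω› := iSup₂_le fun i _ => N.sigma_le i

lemma sigma_le_sourcesSigma {S : Set Source} {i : Source} (h : i ∈ S) :
    N.sigma i ≤ N.sourcesSigma S := le_iSup₂ (f := fun i (_ : i ∈ S) => N.sigma i) i h

lemma measurable_marks_sources (k : Option ℕ) (j : ℕ) :
    Measurable[N.sourcesSigma (markSources k j)] (N.marks k j) := by
  refine Measurable.prodMk ?_ ?_
  · exact measurable_iff_comap_le.2 (N.sigma_le_sourcesSigma (i := .transmits k j) (by simp [markSources]))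
  · exact measurable_iff_comap_le.2 (N.sigma_le_sourcesSigma (i := .fading k j) (by simp [markSources]))

lemma measurable_allMarks_sources (k : Option ℕ) :
    Measurable[N.sourcesSigma (marksSources k)] (fun ω j => N.marks k j ω) :=
  (@measurable_pi_iff _ _ _ (_) _ _).2 fun j => (N.measurable_marks_sources k j).mono
    (N.sourcesSigma_mono (subset_iUnion _ j)) le_rfl

lemma measurable_nodes_sources (k : Option ℕ) :
    Measurable[N.sourcesSigma {.nodes k}] (N.nodes k).data :=
  measurable_iff_comap_le.2 (N.sigma_le_sourcesSigma (i := .nodes k) rfl)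

lemma measurable_roadData_sources (k : Option ℕ) :
    Measurable[N.sourcesSigma (roadSources k)] (N.roadData k) := by
  refine Measurable.prodMk ?_ ?_
  · exact (N.measurable_nodes_sources k).mono (N.sourcesSigma_mono (by simp [roadSources])) le_rfl
  · exact (N.measurable_allMarks_sources k).mono
      (N.sourcesSigma_mono (subset_insert _ _)) le_rfl

lemma measurable_roads_sources : Measurable[N.sourcesSigma {.roads}] N.roads.data :=
  measurable_iff_comap_le.2 (N.sigma_le_sourcesSigma (i := .roads) rfl)

lemma measurable_linkFading_sources : Measurable[N.sourcesSigma {.linkFading}] N.linkFading :=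
  measurable_iff_comap_le.2 (N.sigma_le_sourcesSigma (i := .linkFading) rfl)

lemma measurable_marks (k : Option ℕ) (j : ℕ) : Measurable (N.marks k j) :=
  (N.measurable_transmits k j).prodMk (N.measurable_fading k j)

lemma measurable_roadData (k : Option ℕ) : Measurable (N.roadData k) :=
  (N.measurable_roadData_sources k).mono (N.sourcesSigma_le _) le_rfl

lemma roadInterference_eq (Pv α r : ℝ) (k : Option ℕ) (ω : Ω) :
    N.roadInterference Pv α r k ω = lineInterference Pv α r (N.line k ω) (N.roadData k ω) := by
  refine tsum_congr fun j => ?_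
  simp only [IsInterferer, dist, norm_location, nodeInterference, roadData, marks,
    PointProcess.data]
  by_cases h : (N.nodes k).present j ω = true
  · simp only [h, true_and, if_true]
    congr
  · simp [h]

lemma otherInterference_eq (Pv α r : ℝ) (ω : Ω) :
    N.otherInterference Pv α r ω = ∑' i, if N.roads.present i ω = true then
      lineInterference Pv α r (N.roads.pt i ω) (N.roadData (some i) ω) else 0 := by
  simp only [otherInterference, roadInterference_eq, line]

/-- The sources of the interference from the roads other than the typical one. -/
def otherSources : Set Source := insert .roads (⋃ i : ℕ, roadSources (some i))

lemma measurable_typicalInterference_sources (Pv α r : ℝ) :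
    Measurable[N.sourcesSigma (roadSources none)] (N.typicalInterference Pv α r) := by
  have : N.typicalInterference Pv α r = fun ω =>
      lineInterference Pv α r (N.typicalAngle, 0) (N.roadData none ω) :=
    funext fun ω => N.roadInterference_eq Pv α r none ω
  rw [this]
  exact ((measurable_lineInterference Pv α r).comp measurable_prodMk_left).comp
    (N.measurable_roadData_sources none)

lemma measurable_otherInterference_sources (Pv α r : ℝ) :
    Measurable[N.sourcesSigma otherSources] (N.otherInterference Pv α r) := by
  have : N.otherInterference Pv α r = _ := funext fun ω => N.otherInterference_eq Pv α r ω
  rw [this]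
  have hroads : Measurable[N.sourcesSigma otherSources] N.roads.data :=
    N.measurable_roads_sources.mono (N.sourcesSigma_mono (by simp [otherSources])) le_rfl
  have hdata : ∀ i, Measurable[N.sourcesSigma otherSources] (N.roadData (some i)) := fun i =>
    (N.measurable_roadData_sources (some i)).mono (N.sourcesSigma_mono
      ((subset_iUnion (fun i : ℕ => roadSources (some i)) i).trans (subset_insert _ _))) le_rfl
  have hi : ∀ i, Measurable[N.sourcesSigma otherSources] fun ω =>
      (N.roads.present i ω, N.roads.pt i ω) := fun i => (measurable_pi_apply i).comp hroads
  -- The σ-algebra of the sources must be given explicitly, in place of the ambient one.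
  refine @Measurable.tsum _ _ _ (N.sourcesSigma otherSources) _ _ _ _ _ _ _ _ _ _ _ _ fun i => ?_
  refine Measurable.ite ?_ ?_ measurable_const
  · exact (measurable_fst.comp (hi i)) (measurableSet_singleton true)
  · exact (measurable_lineInterference Pv α r).comp ((measurable_snd.comp (hi i)).prodMk (hdata i))

lemma measurable_typicalInterference (Pv α r : ℝ) : Measurable (N.typicalInterference Pv α r) :=
  (N.measurable_typicalInterference_sources Pv α r).mono (N.sourcesSigma_le _) le_rfl

lemma measurable_otherInterference (Pv α r : ℝ) : Measurable (N.otherInterference Pv α r) :=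
  (N.measurable_otherInterference_sources Pv α r).mono (N.sourcesSigma_le _) le_rfl

lemma disjoint_roadSources {k k' : Option ℕ} (h : k ≠ k') :
    Disjoint (roadSources k) (roadSources k') := by
  rw [Set.disjoint_left]
  rintro i hi hi'
  simp only [roadSources, marksSources, markSources, mem_insert_iff, mem_iUnion,
    mem_singleton_iff] at hi hi'
  rcases hi with rfl | ⟨j, rfl | rfl⟩ <;> simp_all

namespace IsV2X

variable {N} {P : Measure Ω} {lam mu p : ℝ} {R : ℝ≥0∞}

lemma indepFun_of_disjoint (hN : N.IsV2X P lam R mu p) {A B : Type*} [MeasurableSpace A]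
    [MeasurableSpace B] {f : Ω → A} {g : Ω → B} {S T : Set Source} (hST : Disjoint S T)
    (hf : Measurable[N.sourcesSigma S] f) (hg : Measurable[N.sourcesSigma T] g) :
    IndepFun f g P :=
  (IndepFun_iff_Indep _ _ _).2 <|
    indep_of_indep_of_le (indep_iSup_of_disjoint (fun i => N.sigma_le i) hN.indep hST)
      hf.comap_le hg.comap_le

lemma iIndepFun_of_disjoint (hN : N.IsV2X P lam R mu p) {ι A : Type*} [MeasurableSpace A]
    {f : ι → Ω → A} {S : ι → Set Source} (hS : Pairwise fun i j => Disjoint (S i) (S j))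
    (hf : ∀ i, Measurable[N.sourcesSigma (S i)] (f i)) : iIndepFun f P :=
  iIndep_of_iIndep_of_le (iIndep_iSup_blocks (fun i => N.sigma_le i) hN.indep hS)
    fun i => (hf i).comap_le

lemma iIndepFun_marks (hN : N.IsV2X P lam R mu p) (k : Option ℕ) : iIndepFun (N.marks k) P := by
  refine hN.iIndepFun_of_disjoint (S := markSources k) ?_ (N.measurable_marks_sources k)
  intro i j hij
  simpa [markSources] using hij.symm

lemma indepFun_nodes_marks (hN : N.IsV2X P lam R mu p) (k : Option ℕ) :
    IndepFun (N.nodes k).data (fun ω j => N.marks k j ω) P :=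
  hN.indepFun_of_disjoint (by simp [marksSources, markSources]) (N.measurable_nodes_sources k)
    (N.measurable_allMarks_sources k)

lemma iIndepFun_roadData (hN : N.IsV2X P lam R mu p) :
    iIndepFun (fun i : ℕ => N.roadData (some i)) P :=
  hN.iIndepFun_of_disjoint (S := fun i => roadSources (some i))
    (fun i j hij => disjoint_roadSources (by simpa using hij))
    fun i => N.measurable_roadData_sources (some i)

lemma indepFun_roads_roadData (hN : N.IsV2X P lam R mu p) :
    IndepFun N.roads.data (fun ω (i : ℕ) => N.roadData (some i) ω) P := by
  refine hN.indepFun_of_disjoint (T := ⋃ i : ℕ, roadSources (some i)) ?_ N.measurable_roads_sources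
    ((@measurable_pi_iff _ _ _ (_) _ _).2 fun i => (N.measurable_roadData_sources (some i)).mono
      (N.sourcesSigma_mono (subset_iUnion (fun i : ℕ => roadSources (some i)) i)) le_rfl)
  simp [roadSources, marksSources, markSources]

lemma indepFun_other_typical (hN : N.IsV2X P lam R mu p) (Pv α r : ℝ) :
    IndepFun (N.otherInterference Pv α r) (N.typicalInterference Pv α r) P := by
  refine hN.indepFun_of_disjoint ?_ (N.measurable_otherInterference_sources Pv α r)
    (N.measurable_typicalInterference_sources Pv α r)
  rw [otherSources, disjoint_insert_left, disjoint_iUnion_left]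
  exact ⟨by simp [roadSources, marksSources, markSources],
    fun i => disjoint_roadSources (by simp)⟩

lemma indepFun_interference_linkFading (hN : N.IsV2X P lam R mu p) (Pv α r : ℝ) :
    IndepFun (fun ω => N.otherInterference Pv α r ω + N.typicalInterference Pv α r ω)
      N.linkFading P := by
  refine hN.indepFun_of_disjoint (S := otherSources ∪ roadSources none) ?_
    (Measurable.add
      ((N.measurable_otherInterference_sources Pv α r).mono
        (N.sourcesSigma_mono subset_union_left) le_rfl)
      ((N.measurable_typicalInterference_sources Pv α r).mono
        (N.sourcesSigma_mono subset_union_right) le_rfl))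
    N.measurable_linkFading_sources
  simp [otherSources, roadSources, marksSources, markSources]

/-! ### Laplace transforms of the interference -/

/-- A silent node contributes the factor 1, a transmitting one the exponential transform 1 / (1 +
c). Treating the decision as a mark takes the place of thinning the node process. -/
lemma lintegral_ennExpNeg_node [IsProbabilityMeasure P] (hN : N.IsV2X P lam R mu p)
    (hp0 : 0 ≤ p) (hp1 : p ≤ 1) {Pv α r s : ℝ} (hPv : 0 < Pv) (hs : 0 < s) (ℓ : ℝ × ℝ) (k : Option ℕ)
    (j : ℕ) (t : ℝ) :
    ∫⁻ ω, ennExpNeg (ENNReal.ofReal s * nodeInterference Pv α r ℓ (t, N.marks k j ω)) ∂P =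
      ENNReal.ofReal (nodeLaplace p Pv α r s ℓ t) := by
  by_cases hr : r < √(ℓ.2 ^ 2 + t ^ 2)
  swap
  · simp [nodeInterference, nodeLaplace, hr]
  set D := √(ℓ.2 ^ 2 + t ^ 2) with hD
  set c := s * Pv * D ^ (-α) with hc
  have hD0 : 0 ≤ D := Real.sqrt_nonneg _
  have hc0 : 0 ≤ c := by positivity
  let T : Set Ω := {ω | N.transmits k j ω = true}
  have hT : MeasurableSet T := N.measurable_transmits k j (measurableSet_singleton true)
  let g : Ω → ℝ≥0∞ := fun ω => ennExpNeg (ENNReal.ofReal (c * N.fading k j ω))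
  have hg : Measurable g := by
    have := N.measurable_fading k j
    fun_prop
  have hgi : ∫⁻ ω, g ω ∂P = ENNReal.ofReal (1 / (1 + c)) := by
    rw [← lintegral_ennExpNeg_mul_expMeasure hc0, ← (hN.fading_law k j).map_eq,
      lintegral_map (by fun_prop) (N.measurable_fading k j)]
  have hsplit : ∀ ω, ennExpNeg (ENNReal.ofReal s * nodeInterference Pv α r ℓ (t, N.marks k j ω)) =
      Tᶜ.indicator 1 ω + T.indicator 1 ω * g ω := by
    intro ω
    by_cases h : N.transmits k j ω = true
    · have h1 : ω ∈ T := h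
      have h2 : ω ∉ Tᶜ := fun h' => h' h
      simp only [nodeInterference, marks, h, ← hD, hr, and_self, if_true, h1, h2,
        indicator_of_mem, indicator_of_notMem, not_false_eq_true, Pi.one_apply, zero_add, one_mul, g]
      rw [← ENNReal.ofReal_mul hs.le, hc]
      ring_nf
    · have h1 : ω ∉ T := h
      have h2 : ω ∈ Tᶜ := h
      simp [nodeInterference, marks, h, h1]
  have hind : IndepFun (T.indicator (1 : Ω → ℝ≥0∞)) g P := by
    have h0 : IndepFun (N.transmits k j) (N.fading k j) P := by
      refine hN.indepFun_of_disjoint (S := {.transmits k j}) (T := {.fading k j}) (by simp) ?_ ?_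
      · exact measurable_iff_comap_le.2 (N.sigma_le_sourcesSigma (i := .transmits k j) rfl)
      · exact measurable_iff_comap_le.2 (N.sigma_le_sourcesSigma (i := .fading k j) rfl)
    have hTi : T.indicator (1 : Ω → ℝ≥0∞) =
        (fun b => if b = true then (1 : ℝ≥0∞) else 0) ∘ N.transmits k j := by
      funext ω
      by_cases h : N.transmits k j ω = true <;> simp [T, indicator, h]
    rw [hTi]
    exact h0.comp (φ := fun b => if b = true then (1 : ℝ≥0∞) else 0)
      (ψ := fun x => ennExpNeg (ENNReal.ofReal (c * x))) (by fun_prop) (by fun_prop)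
  simp_rw [hsplit]
  rw [lintegral_add_left (measurable_one.indicator hT.compl),
    lintegral_mul_eq_lintegral_mul_lintegral_of_indepFun''
      (measurable_one.indicator hT).aemeasurable hg.aemeasurable hind, hgi,
    lintegral_indicator_one hT, lintegral_indicator_one hT.compl, prob_compl_eq_one_sub hT,
    hN.transmits_prob k j, nodeLaplace, if_pos hr, ← hD, ← hc, ← ENNReal.ofReal_one,
    ← ENNReal.ofReal_sub _ hp0, ← ENNReal.ofReal_mul hp0,
    ← ENNReal.ofReal_add (by linarith) (by positivity)]
  congr 1
  ring

lemma lintegral_ennExpNeg_line [IsProbabilityMeasure P] (hN : N.IsV2X P lam R mu p)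
    (hp0 : 0 ≤ p) (hp1 : p ≤ 1) {Pv α r s : ℝ} (hPv : 0 < Pv) (hs : 0 < s) (ℓ : ℝ × ℝ)
    (k : Option ℕ) :
    ∫⁻ ω, ennExpNeg (ENNReal.ofReal s * lineInterference Pv α r ℓ (N.roadData k ω)) ∂P =
      ennExpNeg (ENNReal.ofReal mu *
        ∫⁻ t, (1 - ENNReal.ofReal (nodeLaplace p Pv α r s ℓ t))) := by
  have : SigmaFinite (ENNReal.ofReal mu • (volume : Measure ℝ)) :=
    sigmaFinite_ofReal_smul mu _
  have h := (hN.nodes_isPoisson k).lintegral_ennExpNeg_tsum_marked (N.measurable_marks k)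
    (hN.indepFun_nodes_marks k) (hN.iIndepFun_marks k)
    (F := fun q => ENNReal.ofReal s * nodeInterference Pv α r ℓ q)
    (((measurable_nodeInterference Pv α r).comp measurable_prodMk_left).const_mul _)
    (fun j t => hN.lintegral_ennExpNeg_node hp0 hp1 hPv hs ℓ k j t)
  rw [lintegral_smul_measure, smul_eq_mul] at h
  rw [← h]
  simp only [lineInterference, ← ENNReal.tsum_mul_left, mul_ite, mul_zero]
  rfl

lemma lintegral_ennExpNeg_other [IsProbabilityMeasure P] (hN : N.IsV2X P lam R mu p)
    (hp0 : 0 ≤ p) (hp1 : p ≤ 1) {Pv α r s : ℝ} (hPv : 0 < Pv) (hs : 0 < s) :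
    ∫⁻ ω, ennExpNeg (ENNReal.ofReal s * N.otherInterference Pv α r ω) ∂P =
      ennExpNeg (∫⁻ ℓ, (1 - ennExpNeg (ENNReal.ofReal mu *
        ∫⁻ t, (1 - ENNReal.ofReal (nodeLaplace p Pv α r s ℓ t)))) ∂(lineIntensity lam R)) := by
  have : SigmaFinite (lineIntensity lam R) :=
    sigmaFinite_ofReal_smul lam _
  have h := hN.roads_isPoisson.lintegral_ennExpNeg_tsum_marked
    (fun i => N.measurable_roadData (some i)) hN.indepFun_roads_roadData hN.iIndepFun_roadData
    (F := fun q => ENNReal.ofReal s * lineInterference Pv α r q.1 q.2)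
    ((measurable_lineInterference Pv α r).const_mul _)
    (fun i ℓ => hN.lintegral_ennExpNeg_line hp0 hp1 hPv hs ℓ (some i))
  rw [← h]
  simp only [otherInterference_eq, ← ENNReal.tsum_mul_left, mul_ite, mul_zero]

/-! ### The success probability -/

/-- The tail of the exponential law is itself an exponential; at `c = ∞` both sides vanish. -/
lemma expMeasure_sinr {Pv α z r : ℝ} (hPv : 0 < Pv) (hz : 0 < z) (hr : 0 < r) (c : ℝ≥0∞) :
    expMeasure 1 {h | ENNReal.ofReal z * c < ENNReal.ofReal (Pv * r ^ (-α) * h)} =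
      ennExpNeg (ENNReal.ofReal (z * r ^ α / Pv) * c) := by
  have hs : 0 < z * r ^ α / Pv := by positivity
  rcases eq_or_ne c ∞ with rfl | hc
  · simp [ENNReal.mul_top, hz, hs]
  lift c to NNReal using hc
  rw [← ENNReal.ofReal_coe_nnreal, ← ENNReal.ofReal_mul hs.le, ← ENNReal.ofReal_mul hz.le,
    ennExpNeg_ofReal (by positivity), ← expMeasure_one_Ioi (by positivity)]
  congr 1
  ext h
  rw [mem_ofPred_eq, mem_Ioi, ENNReal.ofReal_lt_ofReal_iff_of_nonneg (by positivity),
    Real.rpow_neg hr.le]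
  have hrα : 0 < r ^ α := by positivity
  rw [div_mul_eq_mul_div, div_lt_iff₀ hPv, mul_assoc Pv, ← div_eq_inv_mul, ← mul_div_assoc,
    lt_div_iff₀ hrα]
  constructor <;> intro h <;> linarith

lemma successProb_eq [IsProbabilityMeasure P] (hN : N.IsV2X P lam R mu p) {Pv α σ z r : ℝ}
    (hPv : 0 < Pv) (hz : 0 < z) (hr : 0 < r) :
    N.successProb P Pv α σ z r =
      Real.exp (-(z * σ ^ 2 * r ^ α / Pv)) *
        laplace P (N.otherInterference Pv α r) (z * r ^ α / Pv) *
        laplace P (N.typicalInterference Pv α r) (z * r ^ α / Pv) := by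
  have hO := N.measurable_otherInterference Pv α r
  have hT := N.measurable_typicalInterference Pv α r
  have hL := N.measurable_linkFading
  set s := z * r ^ α / Pv with hs
  let I : Ω → ℝ≥0∞ := fun ω => N.otherInterference Pv α r ω + N.typicalInterference Pv α r ω
  have hI : Measurable I := hO.add hT
  let A : Set (ℝ≥0∞ × ℝ) := {q | ENNReal.ofReal z * (q.1 + ENNReal.ofReal (σ ^ 2)) <
    ENNReal.ofReal (Pv * r ^ (-α) * q.2)}
  have hA : MeasurableSet A := measurableSet_lt (by fun_prop) (by fun_prop)
  have hset : {ω | ENNReal.ofReal z < N.sinr Pv α σ r ω} = (fun ω => (I ω, N.linkFading ω)) ⁻¹' A := by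
    ext ω
    simp only [mem_ofPred_eq, sinr, mem_preimage, A, I]
    set c := N.otherInterference Pv α r ω + N.typicalInterference Pv α r ω + ENNReal.ofReal (σ ^ 2)
    set b := ENNReal.ofReal (Pv * r ^ (-α) * N.linkFading ω) with hb
    -- As `z` is neither 0 nor ∞, clearing the denominator is valid even if that denominator is 0 or
    -- ∞.
    exact ENNReal.lt_div_iff_mul_lt (Or.inr ENNReal.ofReal_ne_top)
      (Or.inr (by simpa using hz))
  have hmap := (indepFun_iff_map_prod_eq_prod_map_map hI.aemeasurable hL.aemeasurable).1
    (hN.indepFun_interference_linkFading Pv α r)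
  have hP : P {ω | ENNReal.ofReal z < N.sinr Pv α σ r ω} =
      ∫⁻ ω, ennExpNeg (ENNReal.ofReal s * (I ω + ENNReal.ofReal (σ ^ 2))) ∂P := by
    have : IsProbabilityMeasure (expMeasure 1) := isProbabilityMeasure_expMeasure one_pos
    rw [hset, ← Measure.map_apply (hI.prodMk hL) hA, hmap, hN.linkFading_law.map_eq,
      Measure.prod_apply hA, lintegral_map (measurable_measure_prodMk_left hA) hI]
    refine lintegral_congr fun ω => ?_
    rw [hs, ← expMeasure_sinr hPv hz hr]
    rfl
  have hs0 : 0 < s := by positivity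
  have hfac : ∀ ω, ennExpNeg (ENNReal.ofReal s * (I ω + ENNReal.ofReal (σ ^ 2))) =
      ENNReal.ofReal (Real.exp (-(z * σ ^ 2 * r ^ α / Pv))) *
        (ennExpNeg (ENNReal.ofReal s * N.otherInterference Pv α r ω) *
          ennExpNeg (ENNReal.ofReal s * N.typicalInterference Pv α r ω)) := by
    intro ω
    have hσ : ENNReal.ofReal (Real.exp (-(z * σ ^ 2 * r ^ α / Pv))) =
        ennExpNeg (ENNReal.ofReal s * ENNReal.ofReal (σ ^ 2)) := by
      rw [← ENNReal.ofReal_mul hs0.le, ennExpNeg_ofReal (by positivity), hs]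
      ring_nf
    rw [hσ, mul_add, mul_add, ennExpNeg_add, ennExpNeg_add, mul_comm]
  rw [successProb, measureReal_def, hP]
  simp_rw [hfac]
  have hind := (hN.indepFun_other_typical Pv α r).comp
    (φ := fun x => ennExpNeg (ENNReal.ofReal s * x))
    (ψ := fun x => ennExpNeg (ENNReal.ofReal s * x)) (by fun_prop) (by fun_prop)
  have hprod := lintegral_mul_eq_lintegral_mul_lintegral_of_indepFun'' (by fun_prop)
    (by fun_prop) hind
  simp only [Function.comp_apply] at hprod
  rw [lintegral_const_mul _ (by fun_prop), hprod,
    ENNReal.toReal_mul, ENNReal.toReal_mul, ENNReal.toReal_ofReal (Real.exp_nonneg _),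
    laplace_eq_toReal hO, laplace_eq_toReal hT, ← mul_assoc]

end IsV2X

end Network

/-! ### Evaluation of the integrals -/

lemma lintegral_even {g : ℝ → ℝ≥0∞} (hg : ∀ t, g (-t) = g t) :
    ∫⁻ t, g t = 2 * ∫⁻ t in Ioi 0, g t := by
  have hneg : ∫⁻ t in Iio 0, g t = ∫⁻ t in Ioi 0, g t := by
    have h := (Measure.measurePreserving_neg (volume : Measure ℝ)).setLIntegral_comp_preimage_emb
      (MeasurableEquiv.neg ℝ).measurableEmbedding g (Iio 0)
    rw [← h]
    simp [hg]
  rw [← lintegral_add_compl g (measurableSet_Ioi (a := (0 : ℝ))), compl_Ioi,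
    ← setLIntegral_congr Iio_ae_eq_Iic, hneg, two_mul]

lemma one_sub_one_div_one_add_bounds {x : ℝ} (hx : 0 ≤ x) :
    0 ≤ 1 - 1 / (1 + x) ∧ 1 - 1 / (1 + x) ≤ 1 ∧ 1 - 1 / (1 + x) ≤ x := by
  have h : 1 - 1 / (1 + x) = x / (1 + x) := by field_simp; ring
  refine ⟨h ▸ by positivity, ?_, ?_⟩
  · have : 0 ≤ 1 / (1 + x) := by positivity
    linarith
  · rw [h]
    exact div_le_self hx (by linarith)

/-- Bounded by 1 near the origin and by K t^(-α) in the tail, which is where α > 1 enters. -/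
lemma integrableOn_attenuation {K α : ℝ} (hK : 0 ≤ K) (hα : 1 < α) (y : ℝ) {a : ℝ} (ha : 0 ≤ a) :
    IntegrableOn (fun t => 1 - 1 / (1 + K * (y ^ 2 + t ^ 2) ^ (-α / 2))) (Ioi a) := by
  have hm : Measurable fun t : ℝ => 1 - 1 / (1 + K * (y ^ 2 + t ^ 2) ^ (-α / 2)) := by fun_prop
  have hb := fun t : ℝ => one_sub_one_div_one_add_bounds
    (x := K * (y ^ 2 + t ^ 2) ^ (-α / 2)) (by positivity)
  refine IntegrableOn.mono_set ?_ (Ioi_subset_Ioi ha)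
  rw [← Ioc_union_Ioi_eq_Ioi zero_le_one]
  refine IntegrableOn.union ?_ ?_
  · refine Measure.integrableOn_of_bounded (M := 1) (by simp) hm.aestronglyMeasurable
      (Filter.Eventually.of_forall fun t => ?_)
    rw [Real.norm_of_nonneg (hb t).1]
    exact (hb t).2.1
  · refine Integrable.mono' (g := fun t => K * t ^ (-α))
      ((integrableOn_Ioi_rpow_of_lt (by linarith) one_pos).const_mul K) hm.aestronglyMeasurable ?_
    filter_upwards [ae_restrict_mem measurableSet_Ioi] with t ht
    have ht0 : 0 < t := one_pos.trans ht
    rw [Real.norm_of_nonneg (hb t).1]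
    refine (hb t).2.2.trans (mul_le_mul_of_nonneg_left ?_ hK)
    calc (y ^ 2 + t ^ 2) ^ (-α / 2) ≤ (t ^ 2) ^ (-α / 2) :=
          Real.rpow_le_rpow_of_nonpos (by positivity) (by nlinarith [sq_nonneg y]) (by linarith)
      _ = t ^ (-α) := by
          rw [← Real.rpow_natCast, ← Real.rpow_mul ht0.le]
          congr 1
          push_cast
          ring

lemma laplaceIn_neg (mu Pv α r s y : ℝ) : laplaceIn mu Pv α r s (-y) = laplaceIn mu Pv α r s y := by
  simp [laplaceIn]

/-- The real square root of a negative number is 0, so the inner formula already covers roads that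
miss the disk. -/
lemma laplaceIn_eq_laplaceOut (mu Pv α s : ℝ) {r y : ℝ} (hr : 0 ≤ r) (hy : r ≤ y) :
    laplaceIn mu Pv α r s y = laplaceOut mu Pv α s y := by
  rw [laplaceIn, laplaceOut, Real.sqrt_eq_zero_of_nonpos (by nlinarith)]

/-- The Laplace transform of the interference from one road. -/
lemma ennExpNeg_lintegral_nodeLaplace {mu p Pv α r s : ℝ} (hmu : 0 ≤ mu) (hp0 : 0 ≤ p)
    (hp1 : p ≤ 1) (hPv : 0 < Pv) (hα : 1 < α) (hr : 0 ≤ r) (hs : 0 < s) (ℓ : ℝ × ℝ) :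
    ennExpNeg (ENNReal.ofReal mu * ∫⁻ t, (1 - ENNReal.ofReal (nodeLaplace p Pv α r s ℓ t))) =
      ENNReal.ofReal (laplaceIn (p * mu) Pv α r s ℓ.2) := by
  set y := ℓ.2 with hy
  set a := √(r ^ 2 - y ^ 2) with ha
  set f : ℝ → ℝ := fun t => 1 - 1 / (1 + s * Pv * (y ^ 2 + t ^ 2) ^ (-α / 2)) with hf
  have hK : 0 ≤ s * Pv := by positivity
  have ha0 : 0 ≤ a := Real.sqrt_nonneg _
  have hb := fun t : ℝ => one_sub_one_div_one_add_bounds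
    (x := s * Pv * (y ^ 2 + t ^ 2) ^ (-α / 2)) (by positivity)
  have hf0 : ∀ t, 0 ≤ f t := fun t => (hb t).1
  have hint : IntegrableOn f (Ioi a) := integrableOn_attenuation hK hα y ha0
  have hnode : ∀ t, 0 < t → 1 - ENNReal.ofReal (nodeLaplace p Pv α r s ℓ t) =
      (Ioi a).indicator (fun t => ENNReal.ofReal (p * f t)) t := by
    intro t ht
    -- The part of the road outside the disk starts at half the chord length `a`.
    have hiff : r < √(y ^ 2 + t ^ 2) ↔ a < t := by
      rw [Real.lt_sqrt hr, ha, Real.sqrt_lt' ht]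
      constructor <;> intro h <;> linarith
    by_cases h : a < t
    · have hD : √(y ^ 2 + t ^ 2) ^ (-α) = (y ^ 2 + t ^ 2) ^ (-α / 2) := by
        rw [Real.sqrt_eq_rpow, ← Real.rpow_mul (by positivity)]
        congr 1
        ring
      rw [indicator_of_mem (mem_Ioi.2 h), nodeLaplace, ← hy, if_pos (hiff.2 h), hD]
      have h1 : 0 ≤ 1 - p * f t := sub_nonneg.2 (mul_le_one₀ hp1 (hf0 t) (hb t).2.1)
      rw [← ENNReal.ofReal_one, ← ENNReal.ofReal_sub _ h1, sub_sub_cancel]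
    · rw [indicator_of_notMem (show t ∉ Ioi a from h), nodeLaplace, ← hy, if_neg (fun h' => h (hiff.1 h'))]
      simp
  have heven : ∀ t, 1 - ENNReal.ofReal (nodeLaplace p Pv α r s ℓ (-t)) =
      1 - ENNReal.ofReal (nodeLaplace p Pv α r s ℓ t) := by
    intro t; simp [nodeLaplace]
  rw [lintegral_even heven, setLIntegral_congr_fun measurableSet_Ioi hnode,
    setLIntegral_indicator measurableSet_Ioi, inter_eq_left.2 (Ioi_subset_Ioi ha0),
    ← ofReal_integral_eq_lintegral_ofReal (hint.const_mul p)
      (Filter.Eventually.of_forall fun t => mul_nonneg hp0 (hf0 t)),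
    integral_const_mul, ← ENNReal.ofReal_ofNat 2, ← ENNReal.ofReal_mul (by norm_num),
    ← ENNReal.ofReal_mul hmu, ennExpNeg_ofReal, laplaceIn]
  · congr 2
    ring
  · have := integral_nonneg (μ := volume.restrict (Ioi a)) (f := f) hf0
    positivity

lemma measurable_nodeLaplace (p Pv α r s : ℝ) :
    Measurable fun q : (ℝ × ℝ) × ℝ => nodeLaplace p Pv α r s q.1 q.2 := by
  have h : Measurable fun q : (ℝ × ℝ) × ℝ => √(q.1.2 ^ 2 + q.2 ^ 2) := by fun_prop
  exact Measurable.ite (measurableSet_lt measurable_const h) (by fun_prop) measurable_const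

/-- The integral of a function of the distance from the road to the origin. -/
lemma lintegral_lineIntensity (lam : ℝ) (R : ℝ≥0∞) {h : ℝ → ℝ≥0∞}
    (hh : Measurable h) (heven : ∀ y, h (-y) = h y) :
    ∫⁻ ℓ, h ℓ.2 ∂(lineIntensity lam R) =
      ENNReal.ofReal (2 * Real.pi * lam) * ∫⁻ y in {y : ℝ | 0 < y ∧ ENNReal.ofReal y < R}, h y := by
  have hS : MeasurableSet {y : ℝ | ENNReal.ofReal |y| < R} :=
    measurableSet_lt (by fun_prop) measurable_const
  rw [lineIntensity, lintegral_smul_measure, Measure.volume_eq_prod, ← Measure.prod_restrict,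
    lintegral_prod _ (by fun_prop)]
  simp only
  -- The angle does not enter the integrand and contributes its range π; evenness in `y` gives the
  -- 2.
  rw [lintegral_const, ← lintegral_indicator hS,
    lintegral_even (fun y => by simp [indicator, heven]),
    setLIntegral_indicator hS]
  have hset : {y : ℝ | ENNReal.ofReal |y| < R} ∩ Ioi 0 =
      {y : ℝ | 0 < y ∧ ENNReal.ofReal y < R} := by
    ext y
    simp only [mem_inter_iff, mem_ofPred_eq, mem_Ioi]
    constructor
    · rintro ⟨h1, h2⟩
      exact ⟨h2, by rwa [abs_of_pos h2] at h1⟩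
    · rintro ⟨h1, h2⟩
      exact ⟨by rwa [abs_of_pos h1], h1⟩
  rw [hset, Measure.restrict_apply_univ, Real.volume_Ico, sub_zero,
    ENNReal.ofReal_mul (by positivity), ENNReal.ofReal_mul (by norm_num), ENNReal.ofReal_ofNat,
    smul_eq_mul]
  ring

/-- Splitting the range of distances at the radius `r`. -/
lemma setLIntegral_split {r : ℝ} {R : ℝ≥0∞} (hr : 0 < r) (hR : ENNReal.ofReal r < R)
    (h : ℝ → ℝ≥0∞) :
    ∫⁻ y in {y : ℝ | 0 < y ∧ ENNReal.ofReal y < R}, h y =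
      (∫⁻ y in {y : ℝ | 0 < y ∧ y < r}, h y) +
        ∫⁻ y in {y : ℝ | r < y ∧ ENNReal.ofReal y < R}, h y := by
  have hm : MeasurableSet {y : ℝ | r < y ∧ ENNReal.ofReal y < R} :=
    measurableSet_Ioi.inter (measurableSet_lt ENNReal.measurable_ofReal measurable_const)
  have hd : Disjoint {y : ℝ | 0 < y ∧ y < r} {y : ℝ | r < y ∧ ENNReal.ofReal y < R} := by
    rw [Set.disjoint_left]
    rintro y ⟨_, h1⟩ ⟨h2, _⟩
    exact lt_asymm h1 h2
  rw [← lintegral_union hm hd]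
  refine setLIntegral_congr ?_
  have hne : ∀ᵐ y : ℝ, y ≠ r := by simp [ae_iff]
  filter_upwards [hne] with y hy
  refine propext ⟨fun ⟨h1, h2⟩ => ?_, ?_⟩
  · rcases lt_or_gt_of_ne hy with h | h
    · exact Or.inl ⟨h1, h⟩
    · exact Or.inr ⟨h, h2⟩
  · rintro (⟨h1, h2⟩ | ⟨h1, h2⟩)
    · exact ⟨h1, (ENNReal.ofReal_le_ofReal h2.le).trans_lt hR⟩
    · exact ⟨hr.trans h1, h2⟩

lemma laplaceIn_zero (mu Pv α s : ℝ) {r : ℝ} (hr : 0 < r) :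
    laplaceIn mu Pv α r s 0 =
      Real.exp (-2 * mu * ∫ t in Ioi r, (1 - 1 / (1 + s * Pv * t ^ (-α)))) := by
  rw [laplaceIn, zero_pow two_ne_zero, sub_zero, Real.sqrt_sq hr.le]
  congr 2
  refine setIntegral_congr_fun measurableSet_Ioi fun t ht => ?_
  have ht0 : (0 : ℝ) ≤ t := (hr.trans ht).le
  have : (0 + t ^ 2) ^ (-α / 2) = t ^ (-α) := by
    rw [zero_add, ← Real.rpow_natCast, ← Real.rpow_mul ht0]
    congr 1
    push_cast
    ring
  simp only [this]

/-- Euler's integral for `₂F₁(1, b; b + 1; x)`. -/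
lemma hyp2F1_one_eq {b : ℝ} (hb : 0 < b) (x : ℝ) :
    hyp2F1 1 b (b + 1) x = b * ∫ t in Ioo (0 : ℝ) 1, t ^ (b - 1) * (1 - x * t)⁻¹ := by
  have hG := (Real.Gamma_pos_of_pos hb).ne'
  rw [hyp2F1, add_sub_cancel_left, Real.Gamma_one, Real.Gamma_add_one hb.ne', mul_one,
    mul_div_cancel_right₀ _ hG]
  simp [Real.rpow_neg_one]

/-- The range of the substitution t = r u^(-1/α), with inverse u = (t / r)^(-α). -/
lemma image_rpow_Ioo {r α : ℝ} (hr : 0 < r) (hα : 0 < α) :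
    (fun u : ℝ => r * u ^ (-1 / α)) '' Ioo 0 1 = Ioi r := by
  ext t
  constructor
  · rintro ⟨u, ⟨hu0, hu1⟩, rfl⟩
    have : 1 < u ^ (-1 / α) :=
      Real.one_lt_rpow_of_pos_of_lt_one_of_neg hu0 hu1 (div_neg_of_neg_of_pos (by norm_num) hα)
    exact lt_mul_of_one_lt_right hr this
  · intro ht
    have ht0 : 0 < t := hr.trans ht
    have h1 : 1 < t / r := (one_lt_div hr).2 ht
    refine ⟨(t / r) ^ (-α), ⟨by positivity, Real.rpow_lt_one_of_one_lt_of_neg h1 (by linarith)⟩, ?_⟩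
    have : -α * (-1 / α) = 1 := by field_simp
    simp only [← Real.rpow_mul (by positivity : (0 : ℝ) ≤ t / r), this, Real.rpow_one]
    field_simp

/-- Under t = r u^(-1/α) the term z r^α t^(-α) becomes z u, and the Jacobian r/α · u^(-1/α - 1)
supplies the power of u in Euler's integral with b = (α - 1)/α and c = b + 1. -/
lemma integral_attenuation_eq_hyp2F1 {r z α : ℝ} (hr : 0 < r) (hz : 0 < z) (hα : 1 < α) :
    ∫ t in Ioi r, (1 - 1 / (1 + z * r ^ α * t ^ (-α))) =
      r * z * hyp2F1 1 ((α - 1) / α) (2 - 1 / α) (-z) / (α - 1) := by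
  have hα0 : 0 < α := by linarith
  have hα1 : α - 1 ≠ 0 := by linarith
  have hc : 2 - 1 / α = (α - 1) / α + 1 := by field_simp; ring
  rw [hc, hyp2F1_one_eq (div_pos (by linarith) hα0), ← image_rpow_Ioo hr hα0,
    integral_image_eq_integral_abs_deriv_smul measurableSet_Ioo
      (f' := fun u => r * (-1 / α * u ^ (-1 / α - 1)))]
  · have hconst : ∀ J : ℝ, r * z * ((α - 1) / α * J) / (α - 1) = r * z / α * J := by
      intro J; field_simp
    rw [hconst, ← integral_const_mul]
    refine setIntegral_congr_fun measurableSet_Ioo fun u hu => ?_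
    have hu0 : 0 < u := hu.1
    have hpow : (r * u ^ (-1 / α)) ^ (-α) = (r ^ α)⁻¹ * u := by
      rw [Real.mul_rpow hr.le (by positivity), ← Real.rpow_mul hu0.le, Real.rpow_neg hr.le]
      have : -1 / α * -α = 1 := by field_simp
      rw [this, Real.rpow_one]
    have habs : |r * (-1 / α * u ^ (-1 / α - 1))| = r / α * u ^ (-1 / α - 1) := by
      have : r * (-1 / α * u ^ (-1 / α - 1)) = -(r / α * u ^ (-1 / α - 1)) := by ring
      rw [this, abs_neg, abs_of_nonneg (by positivity)]
    have hexp : (α - 1) / α - 1 = -1 / α := by field_simp; ring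
    have hsplit : u ^ (-1 / α) = u ^ (-1 / α - 1) * u := by
      rw [← Real.rpow_add_one hu0.ne', sub_add_cancel]
    have hrα : r ^ α ≠ 0 := by positivity
    have hzr : z * r ^ α * ((r ^ α)⁻¹ * u) = z * u := by field_simp
    have hden : 1 + z * u ≠ 0 := by positivity
    simp only [smul_eq_mul]
    rw [habs, hpow, hexp, hzr, hsplit, neg_mul, sub_neg_eq_add]
    field_simp
    ring
  · intro u hu
    exact ((Real.hasDerivAt_rpow_const (Or.inl hu.1.ne')).const_mul r).hasDerivWithinAt
  · intro u hu v hv huv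
    have h : u ^ (-1 / α) = v ^ (-1 / α) := mul_left_cancel₀ hr.ne' huv
    exact Real.rpow_left_injOn (by have := hα0.ne'; simp [this]) hu.1.le hv.1.le h

end

end V2X

/-- The exponent for I_v is an integral in [0, ∞] under `expNeg` because it can diverge: for R = ∞,
p > 0 and α ≤ 2 the outer integrand decays only like y^(1 - α). The transform is then 0, that is,
I_v = ∞ almost surely. -/
theorem mainTheorem1 {Ω : Type*} [MeasurableSpace Ω] (P : Measure Ω) [IsProbabilityMeasure P]
    (N : V2X.Network Ω) (lam mu p Pv α σ z r : ℝ) (R : ℝ≥0∞)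
    (hlam : 0 < lam) (hmu : 0 < mu) (hp0 : 0 ≤ p) (hp1 : p ≤ 1)
    (hPv : 0 < Pv) (hα : 1 < α) (hz : 0 < z) (hr : 0 < r) (hR : ENNReal.ofReal r < R)
    (hN : N.IsV2X P lam R mu p) (s : ℝ) (hs : s = z * r ^ α / Pv) :
    N.successProb P Pv α σ z r =
      Real.exp (-(z * σ ^ 2 * r ^ α / Pv)) *
        V2X.laplace P (N.otherInterference Pv α r) s *
        V2X.laplace P (N.typicalInterference Pv α r) s ∧
    V2X.laplace P (N.otherInterference Pv α r) s =
      V2X.expNeg (ENNReal.ofReal (2 * Real.pi * lam) *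
        ((∫⁻ y in {y : ℝ | 0 < y ∧ y < r},
            ENNReal.ofReal (1 - V2X.laplaceIn (p * mu) Pv α r s y)) +
          ∫⁻ y in {y : ℝ | r < y ∧ ENNReal.ofReal y < R},
            ENNReal.ofReal (1 - V2X.laplaceOut (p * mu) Pv α s y))) ∧
    V2X.laplace P (N.typicalInterference Pv α r) s =
      Real.exp (-2 * (p * mu) * ∫ t in Ioi r, (1 - 1 / (1 + s * Pv * t ^ (-α)))) ∧
    V2X.laplace P (N.typicalInterference Pv α r) s =
      Real.exp (-(2 * r * z * (p * mu) *
        V2X.hyp2F1 1 ((α - 1) / α) (2 - 1 / α) (-z) / (α - 1))) := by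
  have hs0 : 0 < s := by rw [hs]; positivity
  have hline := V2X.ennExpNeg_lintegral_nodeLaplace hmu.le hp0 hp1 hPv hα hr.le hs0 (r := r)
  have htyp : V2X.laplace P (N.typicalInterference Pv α r) s =
      Real.exp (-2 * (p * mu) * ∫ t in Ioi r, (1 - 1 / (1 + s * Pv * t ^ (-α)))) := by
    have hT : N.typicalInterference Pv α r = fun ω =>
        V2X.lineInterference Pv α r (N.typicalAngle, 0) (N.roadData none ω) :=
      funext fun ω => N.roadInterference_eq Pv α r none ω
    rw [V2X.laplace_eq_toReal (N.measurable_typicalInterference Pv α r), hT,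
      hN.lintegral_ennExpNeg_line hp0 hp1 hPv hs0, hline, V2X.laplaceIn_zero _ _ _ _ hr,
      ENNReal.toReal_ofReal (Real.exp_nonneg _)]
  refine ⟨hs ▸ hN.successProb_eq hPv hz hr, ?_, htyp, ?_⟩
  · rw [V2X.laplace_eq_toReal (N.measurable_otherInterference Pv α r),
      hN.lintegral_ennExpNeg_other hp0 hp1 hPv hs0, V2X.expNeg_eq_toReal]
    simp_rw [hline]
    have hsub : ∀ y, 1 - ENNReal.ofReal (V2X.laplaceIn (p * mu) Pv α r s y) =
        ENNReal.ofReal (1 - V2X.laplaceIn (p * mu) Pv α r s y) := fun y => by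
      rw [ENNReal.ofReal_sub _ (by unfold V2X.laplaceIn; positivity), ENNReal.ofReal_one]
    simp_rw [hsub]
    -- Measurability in `y` is read off the iterated-integral form in `hline`, on lines of angle 0.
    have hmeas : Measurable fun y =>
        ENNReal.ofReal (1 - V2X.laplaceIn (p * mu) Pv α r s y) := by
      simp_rw [← hsub]
      have h := fun y : ℝ => hline (0, y)
      simp only at h
      simp_rw [← h]
      have hm := (V2X.measurable_nodeLaplace p Pv α r s).comp
        (measurable_prodMk_left (x := (0 : ℝ)).prodMap measurable_id)
      have hm' : Measurable fun y : ℝ =>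
          ∫⁻ t, (1 - ENNReal.ofReal (V2X.nodeLaplace p Pv α r s (0, y) t)) :=
        Measurable.lintegral_prod_right' (f := fun q : ℝ × ℝ =>
          1 - ENNReal.ofReal (V2X.nodeLaplace p Pv α r s (0, q.1) q.2))
          (measurable_const.sub hm.ennreal_ofReal)
      fun_prop
    rw [V2X.lintegral_lineIntensity lam R hmeas (fun y => by rw [V2X.laplaceIn_neg]),
      V2X.setLIntegral_split hr hR]
    congr 4
    refine setLIntegral_congr_fun (measurableSet_Ioi.inter
      (measurableSet_lt ENNReal.measurable_ofReal measurable_const)) fun y hy => ?_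
    rw [V2X.laplaceIn_eq_laplaceOut _ _ _ _ hr.le hy.1.le]
  · rw [htyp]
    have hsP : s * Pv = z * r ^ α := by rw [hs]; field_simp
    rw [hsP, V2X.integral_attenuation_eq_hyp2F1 hr hz hα]
    congr 1
    ring
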